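/- **Setting.** A range space $(\mathcal X,\mathcal R)$ consists of a finite set $\mathcal X$ with a probability measure $\mathrm P$ and a family $\mathcal R\subseteq 2^{\mathcal X}$ of (measurable) subsets. Its VC-dimension is the maximal size of a set $Y\subseteq\mathcal X$ with $\{R\cap Y: R\in\mathcal R\}=2^Y$. For $\epsilon>0$, an $\epsilon$-net is a set $S\subseteq \mathrm{supp}(\mathrm P)$ with $R\cap S\neq\emptyset$ for every $R\in\mathcal R$ with $\mathrm P(R)\ge\epsilon$. Put $\mathcal R_{\le t}:=\{R\in\mathcal R:\mathrm P(R)\le t\}$. Alexander's capacity is $$\tau(\epsilon):=\sup_{\epsilon_0\ge\epsilon}\frac{\mathrm P\big(\bigcup_{R\in\mathcal R_{\le\epsilon_0}}R\big)}{\epsilon_0},$$ and the doubling constant at scale $\epsilon$ is $\sup_{\epsilon_0\ge\epsilon}\mathcal M(\mathcal R_{\le 2\epsilon_0},\epsilon_0)$, where $\mathcal M(\mathcal R',t)$ is the maximal size of a subfamily $\mathcal Q\subseteq\mathcal R'$ with $\mathrm P(A\,\Delta\,B)\ge t$ for all distinct $A,B\in\mathcal Q$. **Theorem 4.** There are absolute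 constants $C,c>0$ such that the following holds. Let $(\mathcal X,\mathcal R)$ be a range space of VC-dimension at most $d$, let $\epsilon>0$, and let the real number $D_\epsilon$ be an upper bound on its doubling constant at scale $\epsilon$. Put $\tau_i:=\tau(2^i\epsilon)$ and $z:=1+\lceil\log_2\frac1\epsilon\rceil$. (i) If $D_\epsilon\ge 2\tau_1$, then there is an $\epsilon$-net for $(\mathcal X,\mathcal R)$ of size at most $$C\sum_{i=1}^{z}\Big(\log\frac{D_\epsilon}{\tau_i}+d\Big)\tau_i ,$$ where a term with $\tau_i=0$ is read as $0$. The same holds if $\tau$ is replaced throughout by $\max\{\tau,1\}$. (ii) If $d\ge1$ and $D_\epsilon\le\frac1{2\epsilon}$, then there is an $\epsilon$-net for $(\mathcal X,\mathcal R)$ of size at most $C\,dD_\epsilon\log\frac1{\epsilon D_\epsilon}$ (read as $0$ if $D_\epsilon=0$, which forces $\mathcal R=\emptyset$). Moreover, for all integers $n\ge1$, $d\ge0$ and all reals $\epsilon>d/n$ and $2\le D_\epsilon<\frac1{2\epsilon}$ there is a range space on $n$ points with the uniform measure, of VC-dimension at most $d$ and doubling constant at scale $\epsilon$ at most $D_\epsilon$,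 all of whose $\epsilon$-nets have size at least $c\,dD_\epsilon\log\frac1{\epsilon D_\epsilon}$. -/

import Mathlib

open MeasureTheory

/-!
A range space is a finite set `X` with a probability measure `P` and a finite family
`𝓡 : Finset (Finset X)` of ranges. Its VC-dimension is `𝓡.vcDim`.
-/

noncomputable section

namespace RangeSpace

variable {X : Type*} [DecidableEq X] [MeasurableSpace X]

/-- `S` is an `ε`-net: a set of points in the support of `P` (for a finite `X`, the points of
nonzero mass) that meets every range of measure at least `ε`. -/
def IsEpsNet (P : Measure X) (𝓡 : Finset (Finset X)) (ε : ℝ) (S : Finset X) : Prop :=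
  (∀ x ∈ S, P {x} ≠ 0) ∧ ∀ R ∈ 𝓡, ε ≤ P.real (R : Set X) → (R ∩ S).Nonempty

open Classical in
/-- The ranges of measure at most `t`. -/
def rangesLE (P : Measure X) (𝓡 : Finset (Finset X)) (t : ℝ) : Finset (Finset X) :=
  𝓡.filter fun R => P.real (R : Set X) ≤ t

/-- Alexander's capacity `τ(ε) = sup_{ε₀ ≥ ε} P(⋃ {R ∈ 𝓡 : P(R) ≤ ε₀}) / ε₀`, for `ε > 0`
(the supremum is over a nonempty set of numbers in `[0, 1 / ε]`). -/
def capacity (P : Measure X) (𝓡 : Finset (Finset X)) (ε : ℝ) : ℝ :=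
  sSup ((fun ε₀ : ℝ => P.real (⋃ R ∈ rangesLE P 𝓡 ε₀, (R : Set X)) / ε₀) '' Set.Ici ε)

/-- Alexander's capacity, cut off from below at the constant `1`. -/
def truncCapacity (P : Measure X) (𝓡 : Finset (Finset X)) (ε : ℝ) : ℝ :=
  max (capacity P 𝓡 ε) 1

/-- `𝓠` is `t`-separated for the distance `ρ(A, B) = P(A Δ B)`. -/
def IsPacking (P : Measure X) (t : ℝ) (𝓠 : Finset (Finset X)) : Prop :=
  ∀ A ∈ 𝓠, ∀ B ∈ 𝓠, A ≠ B → t ≤ P.real (symmDiff A B : Finset X)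

open Classical in
/-- The packing number: the largest size of a `t`-separated subfamily of `𝓡`. -/
def packingNumber (P : Measure X) (𝓡 : Finset (Finset X)) (t : ℝ) : ℕ :=
  (𝓡.powerset.filter fun 𝓠 => IsPacking P t 𝓠).sup Finset.card

/-- The doubling constant `sup_{ε₀ ≥ ε} M(𝓡_{≤ 2 ε₀}, ε₀)` (the supremum is over a nonempty set
of natural numbers bounded by the number of ranges). -/
def doublingConstant (P : Measure X) (𝓡 : Finset (Finset X)) (ε : ℝ) : ℕ :=
  sSup ((fun ε₀ : ℝ => packingNumber P (rangesLE P 𝓡 (2 * ε₀)) ε₀) '' Set.Ici ε)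

/-- The number `z = 1 + ⌈log₂ (1 / ε)⌉` of dyadic scales. It is negative or zero only for
`ε ≥ 2`, and a sum over `1 ≤ i ≤ z` is then empty. -/
def numScales (ε : ℝ) : ℕ :=
  (1 + ⌈Real.logb 2 (1 / ε)⌉).toNat

end RangeSpace

end

/-! Upper bounds. Treat each dyadic scale separately. Among the ranges with s ≤ P(R) ≤ 2s take a
maximal s-separated family 𝓠. The doubling constant gives |𝓠| ≤ D, and by maximality every such
range fills at least a quarter of some Q ∈ 𝓠, so it is enough to stab, inside each Q, the ranges
heavy in Q.

Let the union U of 𝓠 have mass at most 2st. Each Q then has relative mass at least 1/(2t) in U, and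
M random points of U fail for a given Q with probability at most exp(4d - M/(16t)). This comes from
double sampling (`sum_missing_mul_le`, `sum_missing_le_exp`). With M of order t(log(D/t) + d), at
most t·exp(-d) members of 𝓠 fail on average, and each is repaired by its own net of O(d) points.
This alteration (`exists_transversal`) is why the logarithm is of D/t and not of D.

The two upper bounds differ only in t: (i) takes the capacity at the scale; (ii) takes t = D at the
small scales, by the union bound, and then halves t at each further scale, where total mass 1
suffices. The costs in (ii) form a convergent series after about log(1/(εD)) equal terms.

Lower bound. In a block of k + e points, with all its k-subsets as ranges, a net needs e + 1 points,
while the ranges differ pairwise by at most 2e points. With 2e < εn a packing sees only one range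
per block. Disjoint blocks, about D/2 for each size 5^i⌈εn⌉, keep the doubling constant below D and
leave room for about log(1/(εD)) sizes. -/

namespace RangeSpace

/-! ### Double sampling: the probability of missing a heavy set. -/

section Sampling

variable {X : Type*} [DecidableEq X]

/-- Passing to traces on a set does not increase the VC-dimension. -/
lemma vcDim_image_inter_le (𝓡 : Finset (Finset X)) (Z : Finset X) :
    (𝓡.image fun R => R ∩ Z).vcDim ≤ 𝓡.vcDim := by
  refine Finset.sup_le fun s hs => ?_
  rw [Finset.mem_shatterer] at hs
  have hsZ : s ⊆ Z := by
    obtain ⟨u, hu, hsu⟩ := hs.exists_superset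
    obtain ⟨R, -, rfl⟩ := Finset.mem_image.1 hu
    exact hsu.trans Finset.inter_subset_right
  refine Finset.Shatters.card_le_vcDim fun t ht => ?_
  obtain ⟨u, hu, rfl⟩ := hs ht
  obtain ⟨R, hR, rfl⟩ := Finset.mem_image.1 hu
  refine ⟨R, hR, ?_⟩
  ext a
  simp only [Finset.mem_inter]
  exact ⟨fun h => ⟨h.1, h.2, hsZ h.1⟩, fun h => ⟨h.1, h.2.1⟩⟩

/-- The Sauer-Shelah lemma with the binomial sum replaced by its generating function bound. -/
lemma pow_mul_card_le_of_vcDim_le {𝓑 : Finset (Finset X)} {Z : Finset X} {d : ℕ} {x : ℝ}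
    (hZ : ∀ B ∈ 𝓑, B ⊆ Z) (hd : 𝓑.vcDim ≤ d) (hx : 0 < x) (hx1 : x ≤ 1) :
    x ^ d * (𝓑.card : ℝ) ≤ (1 + x) ^ Z.card := by
  have hsub : 𝓑.shatterer ⊆ Z.powerset := fun s hs => by
    obtain ⟨u, hu, hsu⟩ := (Finset.mem_shatterer.1 hs).exists_superset
    exact Finset.mem_powerset.2 (hsu.trans (hZ u hu))
  calc x ^ d * (𝓑.card : ℝ) ≤ x ^ d * (𝓑.shatterer.card : ℝ) := by
        have := Finset.card_le_card_shatterer 𝓑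
        exact mul_le_mul_of_nonneg_left (by exact_mod_cast this) (by positivity)
    _ = ∑ _s ∈ 𝓑.shatterer, x ^ d := by rw [Finset.sum_const, nsmul_eq_mul, mul_comm]
    _ ≤ ∑ s ∈ 𝓑.shatterer, x ^ s.card := Finset.sum_le_sum fun s hs =>
        pow_le_pow_of_le_one hx.le hx1 ((Finset.mem_shatterer.1 hs).card_le_vcDim.trans hd)
    _ ≤ ∑ s ∈ Z.powerset, x ^ s.card :=
        Finset.sum_le_sum_of_subset_of_nonneg hsub fun _ _ _ => by positivity
    _ = (1 + x) ^ Z.card := by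
        have := Finset.sum_pow_mul_eq_add_pow x 1 Z
        simpa [add_comm] using this

/-- The symmetrization functional of a set `B` on a pair of points: it vanishes when the first
point lies in `B` and charges the second point a factor `2` for lying in `B`. -/
def pairCharge (B : Finset X) (z : X × X) : ℝ :=
  if z.1 ∈ B then 0 else if z.2 ∈ B then 2 else 1

lemma pairCharge_nonneg (B : Finset X) (z : X × X) : 0 ≤ pairCharge B z := by
  unfold pairCharge; split_ifs <;> norm_num

lemma pairCharge_add_swap_le (B : Finset X) (z : X × X) :
    pairCharge B z + pairCharge B z.swap ≤ 2 := by
  unfold pairCharge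
  simp only [Prod.fst_swap, Prod.snd_swap]
  split_ifs <;> norm_num

/-- The points of `Q` that occur in a sequence of pairs. -/
def samplePoints {M : ℕ} (Q : Finset X) (z : Fin M → X × X) : Finset X :=
  Finset.univ.biUnion fun j => ({(z j).1, (z j).2} : Finset X) ∩ Q

/-- The charge sees a range only through its trace on the sample, so the union bound runs over
traces instead of ranges. -/
lemma pairCharge_inter_samplePoints {M : ℕ} {Q R : Finset X} (hR : R ⊆ Q) (z : Fin M → X × X)
    (j : Fin M) : pairCharge (R ∩ samplePoints Q z) (z j) = pairCharge R (z j) := by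
  have h1 : (z j).1 ∈ R ∩ samplePoints Q z ↔ (z j).1 ∈ R := by
    simp only [Finset.mem_inter, samplePoints, Finset.mem_biUnion, and_iff_left_iff_imp]
    exact fun h => ⟨j, Finset.mem_univ _, by simp, hR h⟩
  have h2 : (z j).2 ∈ R ∩ samplePoints Q z ↔ (z j).2 ∈ R := by
    simp only [Finset.mem_inter, samplePoints, Finset.mem_biUnion, and_iff_left_iff_imp]
    exact fun h => ⟨j, Finset.mem_univ _, by simp, hR h⟩
  simp only [pairCharge, h1, h2]

/-- Swap the pairs at the indices where `σ` is true. -/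
def swapPairs {Y : Type*} {M : ℕ} (σ : Fin M → Bool) : (Fin M → Y × Y) ≃ (Fin M → Y × Y) :=
  Equiv.piCongrRight fun j => if σ j then Equiv.prodComm Y Y else Equiv.refl _

lemma swapPairs_apply {Y : Type*} {M : ℕ} (σ : Fin M → Bool) (z : Fin M → Y × Y) (j : Fin M) :
    swapPairs σ z j = if σ j then (z j).swap else z j := by
  simp only [swapPairs, Equiv.piCongrRight_apply, Pi.map_apply]
  split_ifs <;> rfl

lemma samplePoints_swapPairs {M : ℕ} (Q : Finset X) (σ : Fin M → Bool) (z : Fin M → X × X) :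
    samplePoints Q (swapPairs σ z) = samplePoints Q z := by
  refine Finset.biUnion_congr rfl fun j _ => ?_
  rw [swapPairs_apply]
  split_ifs
  · rw [Prod.fst_swap, Prod.snd_swap, Finset.pair_comm]
  · rfl

/-- Independent swaps make the average factor over the pairs, and each pair contributes at most 1 on
average. -/
lemma sum_swapPairs_prod_pairCharge_le {M : ℕ} (B : Finset X) (z : Fin M → X × X) :
    ∑ σ : Fin M → Bool, ∏ j, pairCharge B (swapPairs σ z j) ≤ 2 ^ M := by
  have h : ∑ σ : Fin M → Bool, ∏ j, pairCharge B (swapPairs σ z j)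
      = ∏ j, ∑ s : Bool, pairCharge B (if s then (z j).swap else z j) := by
    rw [Fintype.prod_sum]
    simp only [swapPairs_apply]
  rw [h]
  calc _ ≤ ∏ _j : Fin M, (2 : ℝ) := by
        refine Finset.prod_le_prod (fun j _ => Finset.sum_nonneg fun _ _ => pairCharge_nonneg _ _)
          fun j _ => ?_
        rw [Fintype.sum_bool, add_comm]
        simpa using pairCharge_add_swap_le B (z j)
    _ = 2 ^ M := by simp

/-- The right side is a product over the pairs, so its expectation over independent pairs can be
computed exactly. -/
lemma one_add_pow_card_samplePoints_le {M : ℕ} {x : ℝ} (hx : 0 ≤ x) (Q : Finset X)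
    (z : Fin M → X × X) :
    (1 + x) ^ (samplePoints Q z).card ≤
      ∏ j, ((1 + if (z j).1 ∈ Q then x else 0) * (1 + if (z j).2 ∈ Q then x else 0)) := by
  calc (1 + x) ^ (samplePoints Q z).card
      ≤ (1 + x) ^ ∑ j, (({(z j).1, (z j).2} : Finset X) ∩ Q).card :=
        pow_le_pow_right₀ (by linarith) Finset.card_biUnion_le
    _ = ∏ j, (1 + x) ^ (({(z j).1, (z j).2} : Finset X) ∩ Q).card :=
        (Finset.prod_pow_eq_pow_sum _ _ _).symm
    _ ≤ _ := by
        refine Finset.prod_le_prod (fun j _ => by positivity) fun j _ => ?_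
        have hc : (({(z j).1, (z j).2} : Finset X) ∩ Q).card ≤
            (if (z j).1 ∈ Q then 1 else 0) + if (z j).2 ∈ Q then 1 else 0 := by
          rw [Finset.insert_eq, Finset.union_inter_distrib_right]
          refine (Finset.card_union_le _ _).trans (add_le_add ?_ ?_) <;>
            · split_ifs with h <;> simp [h]
        refine (pow_le_pow_right₀ (by linarith) hc).trans ?_
        split_ifs <;> simp [pow_succ]

variable [Fintype X]

/-- The weight of the samples missing some set of `𝓑` of weight at least `p`. -/
lemma sum_missing_mul_le {w : X → ℝ} (hw : ∀ a, 0 ≤ w a) (hw1 : ∑ a, w a = 1)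
    {𝓑 : Finset (Finset X)} {Q : Finset X} (hQ : ∀ B ∈ 𝓑, B ⊆ Q) {d : ℕ} (hd : 𝓑.vcDim ≤ d)
    {x p : ℝ} (hx : 0 < x) (hx1 : x ≤ 1) (hp : 0 ≤ p) (M : ℕ) (F : Finset (Fin M → X))
    (hF : ∀ f ∈ F, ∃ B ∈ 𝓑, p ≤ ∑ a ∈ B, w a ∧ ∀ j, f j ∉ B) :
    x ^ d * ((∑ f ∈ F, ∏ j, w (f j)) * (1 + p) ^ M) ≤ ((1 + x * ∑ a ∈ Q, w a) ^ 2) ^ M := by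
  classical
  let tr : (Fin M → X × X) → Finset (Finset X) := fun z =>
    𝓑.image fun B => B ∩ samplePoints Q z
  let W : (Fin M → X × X) → ℝ := fun z => ∏ j, (w (z j).1 * w (z j).2)
  let H : (Fin M → X × X) → ℝ := fun z => ∑ T ∈ tr z, ∏ j, pairCharge T (z j)
  have hW : ∀ z, 0 ≤ W z := fun z => Finset.prod_nonneg fun j _ => mul_nonneg (hw _) (hw _)
  have hH : ∀ z, 0 ≤ H z := fun z => Finset.sum_nonneg fun T _ =>
    Finset.prod_nonneg fun j _ => pairCharge_nonneg _ _
  -- If `f` misses `B`, the charge of `B` on (f, g) is 2 to the number of hits of the ghost sample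
  -- `g`, with mean (1 + P(B))^M. Using this exponential moment avoids a concentration bound for
  -- `g`.
  have symm : (∑ f ∈ F, ∏ j, w (f j)) * (1 + p) ^ M ≤ ∑ z, W z * H z := by
    have one : ∀ f ∈ F, (1 + p) ^ M ≤
        ∑ g : Fin M → X, (∏ j, w (g j)) * H (fun j => (f j, g j)) := by
      intro f hf
      obtain ⟨B, hB, hpB, hfB⟩ := hF f hf
      calc (1 + p) ^ M ≤ (∑ a, w a * (1 + if a ∈ B then 1 else 0)) ^ M := by
            gcongr
            simp only [mul_add, Finset.sum_add_distrib, mul_one, mul_ite, mul_zero, hw1,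
              Finset.sum_ite_mem, Finset.univ_inter]
            linarith
        _ = ∑ g : Fin M → X, (∏ j, w (g j)) * ∏ j, (1 + if g j ∈ B then 1 else 0) := by
            rw [Fintype.sum_pow]
            exact Finset.sum_congr rfl fun g _ => Finset.prod_mul_distrib
        _ ≤ _ := by
            refine Finset.sum_le_sum fun g _ => mul_le_mul_of_nonneg_left ?_
              (Finset.prod_nonneg fun j _ => hw _)
            have hmem : B ∩ samplePoints Q (fun j => (f j, g j)) ∈ tr (fun j => (f j, g j)) :=
              Finset.mem_image_of_mem _ hB
            refine le_trans (le_of_eq ?_) (Finset.single_le_sum (f := fun T =>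
              ∏ j, pairCharge T (f j, g j)) (fun T _ =>
              Finset.prod_nonneg fun j _ => pairCharge_nonneg _ _) hmem)
            refine Finset.prod_congr rfl fun j _ => ?_
            rw [pairCharge_inter_samplePoints (hQ B hB) (fun j => (f j, g j)) j]
            simp only [pairCharge, hfB j, if_false]
            split_ifs <;> norm_num
    calc (∑ f ∈ F, ∏ j, w (f j)) * (1 + p) ^ M
        = ∑ f ∈ F, (∏ j, w (f j)) * (1 + p) ^ M := Finset.sum_mul _ _ _
      _ ≤ ∑ f ∈ F, (∏ j, w (f j)) *
            ∑ g : Fin M → X, (∏ j, w (g j)) * H (fun j => (f j, g j)) :=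
          Finset.sum_le_sum fun f hf => mul_le_mul_of_nonneg_left (one f hf)
            (Finset.prod_nonneg fun j _ => hw _)
      _ ≤ ∑ f : Fin M → X, (∏ j, w (f j)) *
            ∑ g : Fin M → X, (∏ j, w (g j)) * H (fun j => (f j, g j)) :=
          Finset.sum_le_sum_of_subset_of_nonneg (Finset.subset_univ _) fun f _ _ =>
            mul_nonneg (Finset.prod_nonneg fun j _ => hw _) (Finset.sum_nonneg fun g _ =>
              mul_nonneg (Finset.prod_nonneg fun j _ => hw _) (hH _))
      _ = ∑ fg : (Fin M → X) × (Fin M → X),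
            W (fun j => (fg.1 j, fg.2 j)) * H (fun j => (fg.1 j, fg.2 j)) := by
          rw [Fintype.sum_prod_type]
          refine Finset.sum_congr rfl fun f _ => ?_
          rw [Finset.mul_sum]
          refine Finset.sum_congr rfl fun g _ => ?_
          simp only [W, Finset.prod_mul_distrib]
          ring
      _ = ∑ z, W z * H z :=
          (Equiv.arrowProdEquivProdArrow (Fin M) (fun _ => X) (fun _ => X)).symm.sum_comp
            (fun z => W z * H z)
  -- The weight and the set of traces are invariant under swaps, so each charge may be replaced by
  -- its average over swaps, which is at most 1.
  have swap : ∑ z, W z * H z ≤ ∑ z, W z * (tr z).card := by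
    have inv : ∀ σ : Fin M → Bool, ∑ z, W z * H z =
        ∑ z, W z * ∑ T ∈ tr z, ∏ j, pairCharge T (swapPairs σ z j) := by
      intro σ
      rw [← (swapPairs σ).sum_comp]
      refine Finset.sum_congr rfl fun z _ => ?_
      congr 1
      · refine Finset.prod_congr rfl fun j _ => ?_
        rw [swapPairs_apply]
        split_ifs
        · exact mul_comm _ _
        · rfl
      · simp only [H, tr, samplePoints_swapPairs]
    have key : 2 ^ M * ∑ z, W z * H z ≤ 2 ^ M * ∑ z, W z * (tr z).card := by
      calc (2 : ℝ) ^ M * ∑ z, W z * H z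
          = ∑ _σ : Fin M → Bool, ∑ z, W z * H z := by
            rw [Finset.sum_const, nsmul_eq_mul]; simp
        _ = ∑ σ : Fin M → Bool,
              ∑ z, W z * ∑ T ∈ tr z, ∏ j, pairCharge T (swapPairs σ z j) :=
            Finset.sum_congr rfl fun σ _ => inv σ
        _ = ∑ z, W z * ∑ T ∈ tr z,
              ∑ σ : Fin M → Bool, ∏ j, pairCharge T (swapPairs σ z j) := by
            rw [Finset.sum_comm]
            refine Finset.sum_congr rfl fun z _ => ?_
            rw [← Finset.mul_sum, Finset.sum_comm]
        _ ≤ ∑ z, W z * ∑ _T ∈ tr z, (2 : ℝ) ^ M :=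
            Finset.sum_le_sum fun z _ => mul_le_mul_of_nonneg_left
              (Finset.sum_le_sum fun T _ => sum_swapPairs_prod_pairCharge_le T z) (hW z)
        _ = 2 ^ M * ∑ z, W z * (tr z).card := by
            rw [Finset.mul_sum]
            refine Finset.sum_congr rfl fun z _ => ?_
            rw [Finset.sum_const, nsmul_eq_mul]; ring
    exact le_of_mul_le_mul_left key (by positivity)
  have traces : ∀ z, x ^ d * ((tr z).card : ℝ) ≤
      ∏ j, ((1 + if (z j).1 ∈ Q then x else 0) * (1 + if (z j).2 ∈ Q then x else 0)) := fun z =>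
    (pow_mul_card_le_of_vcDim_le (Z := samplePoints Q z)
      (fun T hT => by
        obtain ⟨B, -, rfl⟩ := Finset.mem_image.1 hT
        exact Finset.inter_subset_right)
      ((vcDim_image_inter_le 𝓑 _).trans hd) hx hx1).trans
      (one_add_pow_card_samplePoints_le hx.le Q z)
  have hq : ∑ a, w a * (1 + if a ∈ Q then x else 0) = 1 + x * ∑ a ∈ Q, w a := by
    simp only [mul_add, Finset.sum_add_distrib, mul_one, mul_ite, mul_zero, hw1,
      Finset.sum_ite_mem, Finset.univ_inter, ← Finset.sum_mul]
    ring
  calc x ^ d * ((∑ f ∈ F, ∏ j, w (f j)) * (1 + p) ^ M)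
      ≤ x ^ d * ∑ z, W z * (tr z).card := by gcongr; exact symm.trans swap
    _ = ∑ z, W z * (x ^ d * (tr z).card) := by
        rw [Finset.mul_sum]; exact Finset.sum_congr rfl fun z _ => by ring
    _ ≤ ∑ z, W z *
          ∏ j, ((1 + if (z j).1 ∈ Q then x else 0) * (1 + if (z j).2 ∈ Q then x else 0)) :=
        Finset.sum_le_sum fun z _ => mul_le_mul_of_nonneg_left (traces z) (hW z)
    _ = (∑ ab : X × X, (w ab.1 * (1 + if ab.1 ∈ Q then x else 0)) *
          (w ab.2 * (1 + if ab.2 ∈ Q then x else 0))) ^ M := by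
        rw [Fintype.sum_pow]
        refine Finset.sum_congr rfl fun z _ => ?_
        simp only [W, ← Finset.prod_mul_distrib]
        exact Finset.prod_congr rfl fun j _ => by ring
    _ = ((1 + x * ∑ a ∈ Q, w a) ^ 2) ^ M := by
        rw [Fintype.sum_prod_type, ← hq, sq, Fintype.sum_mul_sum]

end Sampling

/-! ### Random sampling with alteration at one scale. -/

section OneScale

variable {X : Type*} [DecidableEq X] [Fintype X]

/-- The double sampling bound for traces on `Q` with x = 1/32 and p = q/4. This x is small enough
for (1 + p) to beat (1 + xq)² by a factor exp(q/8), at the price 32^d ≤ exp(4d). -/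
lemma sum_missing_le_exp {w : X → ℝ} (hw : ∀ a, 0 ≤ w a) (hw1 : ∑ a, w a = 1)
    {𝓡 : Finset (Finset X)} {d : ℕ} (hd : 𝓡.vcDim ≤ d) (Q : Finset X) (M : ℕ)
    (F : Finset (Fin M → X))
    (hF : ∀ f ∈ F, ∃ R ∈ 𝓡, (∑ a ∈ Q, w a) / 4 ≤ ∑ a ∈ R ∩ Q, w a ∧ ∀ j, f j ∉ R ∩ Q) :
    ∑ f ∈ F, ∏ j, w (f j) ≤ Real.exp (4 * d - M * (∑ a ∈ Q, w a) / 8) := by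
  set q := ∑ a ∈ Q, w a with hq
  have hq0 : 0 ≤ q := Finset.sum_nonneg fun a _ => hw a
  have hq1 : q ≤ 1 := hw1 ▸ Finset.sum_le_univ_sum_of_nonneg hw
  have main := sum_missing_mul_le hw hw1 (𝓑 := 𝓡.image fun R => R ∩ Q) (Q := Q)
    (fun B hB => by
      obtain ⟨R, -, rfl⟩ := Finset.mem_image.1 hB
      exact Finset.inter_subset_right)
    ((vcDim_image_inter_le 𝓡 Q).trans hd) (x := 1 / 32) (p := q / 4) (by norm_num) (by norm_num)
    (by positivity) M F (fun f hf => by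
      obtain ⟨R, hR, h⟩ := hF f hf
      exact ⟨R ∩ Q, Finset.mem_image_of_mem _ hR, h⟩)
  rw [← hq] at main
  have step : (1 + 1 / 32 * q) ^ 2 ≤ Real.exp (-(q / 8)) * (1 + q / 4) := by
    have := Real.add_one_le_exp (-(q / 8))
    calc (1 + 1 / 32 * q) ^ 2 ≤ (-(q / 8) + 1) * (1 + q / 4) := by nlinarith
      _ ≤ _ := by gcongr
  have h32 : (32 : ℝ) ≤ Real.exp 4 := by
    have h2 : Real.exp 4 = Real.exp 1 ^ 4 := by rw [← Real.exp_nat_mul]; norm_num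
    have h3 := Real.exp_one_gt_d9
    rw [h2]
    calc (32 : ℝ) ≤ 2.7 ^ 4 := by norm_num
      _ ≤ _ := by gcongr; linarith
  have hpos : 0 < (1 + q / 4) ^ M := by positivity
  have h1 : (∑ f ∈ F, ∏ j, w (f j)) * (1 + q / 4) ^ M ≤
      (32 ^ d * Real.exp (-(q / 8)) ^ M) * (1 + q / 4) ^ M := by
    have h2 : ((1 : ℝ) / 32) ^ d * ((∑ f ∈ F, ∏ j, w (f j)) * (1 + q / 4) ^ M) ≤
        Real.exp (-(q / 8)) ^ M * (1 + q / 4) ^ M :=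
      main.trans (by rw [← mul_pow]; gcongr)
    rw [one_div, inv_pow, inv_mul_le_iff₀ (by positivity)] at h2
    linarith
  refine (le_of_mul_le_mul_right h1 hpos).trans ?_
  calc (32 : ℝ) ^ d * Real.exp (-(q / 8)) ^ M ≤ Real.exp 4 ^ d * Real.exp (-(q / 8)) ^ M := by
        gcongr
    _ = _ := by
        rw [← Real.exp_nat_mul, ← Real.exp_nat_mul, ← Real.exp_add]
        congr 1; ring

/-- A random variable on a finite weighted space is at most its mean at some point of positive
weight. -/
lemma exists_pos_weight_le {Ω : Type*} [Fintype Ω] {W N : Ω → ℝ} (hW : ∀ f, 0 ≤ W f)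
    (hW1 : ∑ f, W f = 1) {b : ℝ} (hN : ∑ f, W f * N f ≤ b) : ∃ f, 0 < W f ∧ N f ≤ b := by
  by_contra! h
  have hex : ∃ f, 0 < W f := by
    by_contra! h0
    have : ∑ f, W f ≤ 0 := Finset.sum_nonpos fun f _ => h0 f
    linarith
  obtain ⟨f₀, hf₀⟩ := hex
  have hlt : ∑ f, W f * b < ∑ f, W f * N f := by
    refine Finset.sum_lt_sum (fun f _ => ?_) ⟨f₀, Finset.mem_univ _, ?_⟩
    · rcases (hW f).eq_or_lt with h0 | h0
      · simp [← h0]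
      · exact mul_le_mul_of_nonneg_left (h f h0).le (hW f)
    · exact mul_lt_mul_of_pos_left (h f₀ hf₀) hf₀
  rw [← Finset.sum_mul, hW1, one_mul] at hlt
  linarith

open Classical in
/-- The sets `Q` of `𝓠` in which the sample `f` misses the trace of a range `R` that occupies at
least a quarter of `Q`. -/
noncomputable def missed {M : ℕ} (w : X → ℝ) (𝓡 𝓠 : Finset (Finset X)) (f : Fin M → X) : Finset (Finset X) :=
  𝓠.filter fun Q => ∃ R ∈ 𝓡, (∑ a ∈ Q, w a) / 4 ≤ ∑ a ∈ R ∩ Q, w a ∧ ∀ j, f j ∉ R ∩ Q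

/-- First moment method for independent points drawn from the normalized restriction of `w` to `U`;
a sample of positive probability avoids points of weight zero. -/
lemma exists_sample_card_missed_le {w : X → ℝ} (hw : ∀ a, 0 ≤ w a) {U : Finset X}
    (hU : 0 < ∑ a ∈ U, w a) {𝓡 𝓠 : Finset (Finset X)} {d : ℕ} (hd : 𝓡.vcDim ≤ d) {r : ℝ}
    (h𝓠 : ∀ Q ∈ 𝓠, Q ⊆ U ∧ r * ∑ a ∈ U, w a ≤ ∑ a ∈ Q, w a) (M : ℕ) :
    ∃ f : Fin M → X, (∀ j, w (f j) ≠ 0) ∧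
      ((missed w 𝓡 𝓠 f).card : ℝ) ≤ 𝓠.card * Real.exp (4 * d - M * r / 8) := by
  classical
  set u := ∑ a ∈ U, w a with hu
  let v : X → ℝ := fun a => if a ∈ U then w a / u else 0
  have hv : ∀ a, 0 ≤ v a := fun a => by
    simp only [v]; split_ifs
    · exact div_nonneg (hw a) hU.le
    · rfl
  have hvsub : ∀ A ⊆ U, ∑ a ∈ A, v a = (∑ a ∈ A, w a) / u := fun A hA => by
    rw [Finset.sum_div]
    exact Finset.sum_congr rfl fun a ha => if_pos (hA ha)
  have hv1 : ∑ a, v a = 1 := by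
    simp only [v, Finset.sum_ite_mem, Finset.univ_inter, ← Finset.sum_div]
    exact div_self hU.ne'
  have hmean : ∑ f : Fin M → X, (∏ j, v (f j)) * ((missed w 𝓡 𝓠 f).card : ℝ) ≤
      𝓠.card * Real.exp (4 * d - M * r / 8) := by
    calc ∑ f : Fin M → X, (∏ j, v (f j)) * ((missed w 𝓡 𝓠 f).card : ℝ)
        = ∑ f : Fin M → X, ∑ Q ∈ 𝓠, if Q ∈ missed w 𝓡 𝓠 f then ∏ j, v (f j) else 0 := by
          refine Finset.sum_congr rfl fun f _ => ?_
          have hsub : missed w 𝓡 𝓠 f ⊆ 𝓠 := Finset.filter_subset _ _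
          rw [Finset.sum_ite_mem, Finset.inter_eq_right.2 hsub, Finset.sum_const, nsmul_eq_mul, mul_comm]
      _ = ∑ Q ∈ 𝓠, ∑ f : Fin M → X with Q ∈ missed w 𝓡 𝓠 f, ∏ j, v (f j) := by
          rw [Finset.sum_comm]
          exact Finset.sum_congr rfl fun Q _ => (Finset.sum_filter _ _).symm
      _ ≤ ∑ _Q ∈ 𝓠, Real.exp (4 * d - M * r / 8) := by
          refine Finset.sum_le_sum fun Q hQ => ?_
          obtain ⟨hQU, hrQ⟩ := h𝓠 Q hQ
          refine (sum_missing_le_exp hv hv1 hd Q M _ fun f hf => ?_).trans ?_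
          · obtain ⟨-, R, hR, h1, h2⟩ := Finset.mem_filter.1 (Finset.mem_filter.1 hf).2
            refine ⟨R, hR, ?_, h2⟩
            rw [hvsub Q hQU, hvsub _ (Finset.inter_subset_right.trans hQU), div_right_comm]
            exact div_le_div_of_nonneg_right h1 hU.le
          · have : r ≤ ∑ a ∈ Q, v a := by rw [hvsub Q hQU, le_div_iff₀ hU]; exact hrQ
            gcongr
      _ = 𝓠.card * Real.exp (4 * d - M * r / 8) := by rw [Finset.sum_const, nsmul_eq_mul]
  obtain ⟨f, hf, hfm⟩ := exists_pos_weight_le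
    (fun f : Fin M → X => Finset.prod_nonneg fun j _ => hv (f j))
    (by rw [← Fintype.sum_pow, hv1, one_pow]) hmean
  refine ⟨f, fun j h0 => ?_, hfm⟩
  refine hf.ne' (Finset.prod_eq_zero (Finset.mem_univ j) ?_)
  simp [v, h0]

/-- A set `Q` of positive weight has a net of size linear in the VC-dimension for the ranges that
occupy at least a quarter of it. -/
lemma exists_quarter_net {w : X → ℝ} (hw : ∀ a, 0 ≤ w a) {Q : Finset X}
    (hQ : 0 < ∑ a ∈ Q, w a) {𝓡 : Finset (Finset X)} {d : ℕ} (hd : 𝓡.vcDim ≤ d) :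
    ∃ S : Finset X, (∀ a ∈ S, w a ≠ 0) ∧ S.card ≤ 32 * d + 1 ∧
      ∀ R ∈ 𝓡, (∑ a ∈ Q, w a) / 4 ≤ ∑ a ∈ R ∩ Q, w a → (R ∩ S).Nonempty := by
  obtain ⟨f, hf, hcard⟩ := exists_sample_card_missed_le hw hQ hd (𝓠 := {Q}) (r := 1)
    (fun Q' hQ' => by rw [Finset.mem_singleton.1 hQ']; simp) (32 * d + 1)
  -- With M = 32d + 1 the expected number of failures is exp(-1/8).
  have hlt : ((missed w 𝓡 {Q} f).card : ℝ) < 1 := by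
    refine hcard.trans_lt ?_
    rw [Finset.card_singleton, Nat.cast_one, one_mul, Real.exp_lt_one_iff]
    push_cast
    linarith
  have h0 : missed w 𝓡 {Q} f = ∅ := by
    rw [← Finset.card_eq_zero]
    exact_mod_cast Nat.lt_one_iff.1 (by exact_mod_cast hlt)
  refine ⟨Finset.univ.image f, ?_, ?_, fun R hR hRQ => ?_⟩
  · simpa using hf
  · simpa using Finset.card_image_le (s := Finset.univ) (f := f)
  · by_contra hne
    have : Q ∈ missed w 𝓡 {Q} f := by
      refine Finset.mem_filter.2 ⟨Finset.mem_singleton_self Q, R, hR, hRQ, fun j hj => hne ?_⟩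
      exact ⟨f j, Finset.mem_inter.2 ⟨(Finset.mem_inter.1 hj).1,
        Finset.mem_image_of_mem f (Finset.mem_univ j)⟩⟩
    simp [h0] at this

/-- If every range of `𝓑` occupies a quarter of a member of `𝓠`, then `𝓑` has a small
transversal, in terms of the number of members of `𝓠` and the weight of their union. -/
lemma exists_transversal {w : X → ℝ} (hw : ∀ a, 0 ≤ w a) {𝓑 𝓠 : Finset (Finset X)} {d : ℕ}
    (hd : 𝓑.vcDim ≤ d) {s t D : ℝ} (hs : 0 < s) (ht : 1 / 2 ≤ t) (htD : t ≤ D)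
    (h𝓠 : ∀ Q ∈ 𝓠, s ≤ ∑ a ∈ Q, w a) (hcard : (𝓠.card : ℝ) ≤ D)
    (hU : ∑ a ∈ 𝓠.biUnion id, w a ≤ 2 * s * t)
    (hcov : ∀ R ∈ 𝓑, ∃ Q ∈ 𝓠, (∑ a ∈ Q, w a) / 4 ≤ ∑ a ∈ R ∩ Q, w a) :
    ∃ S : Finset X, (∀ a ∈ S, w a ≠ 0) ∧ (∀ R ∈ 𝓑, (R ∩ S).Nonempty) ∧
      (S.card : ℝ) ≤ 80 * (t * (Real.log (D / t) + d + 1)) := by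
  classical
  have ht0 : 0 < t := by linarith
  have hD0 : 0 < D := by linarith
  have hlog : 0 ≤ Real.log (D / t) := Real.log_nonneg ((one_le_div ht0).2 htD)
  rcases 𝓠.eq_empty_or_nonempty with rfl | ⟨Q₀, hQ₀⟩
  · refine ⟨∅, by simp, fun R hR => ?_, ?_⟩
    · obtain ⟨Q, hQ, -⟩ := hcov R hR
      simp at hQ
    · rw [Finset.card_empty, Nat.cast_zero]; positivity
  set U := 𝓠.biUnion id with hUdef
  have hsub : ∀ Q ∈ 𝓠, Q ⊆ U := fun Q hQ => Finset.subset_biUnion_of_mem id hQ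
  have hUpos : 0 < ∑ a ∈ U, w a := (hs.trans_le (h𝓠 Q₀ hQ₀)).trans_le
    (Finset.sum_le_sum_of_subset_of_nonneg (hsub Q₀ hQ₀) fun a _ _ => hw a)
  -- Chosen so that M/(16t) ≥ log(D/t) + 5d: four of the five d's cancel the factor exp(4d), and the
  -- last leaves exp(-d) to pay for the repairs.
  set M := ⌈16 * (t * (Real.log (D / t) + 5 * d))⌉₊ with hM
  obtain ⟨f, hf, hmiss⟩ := exists_sample_card_missed_le hw hUpos hd (𝓠 := 𝓠) (r := 1 / (2 * t))
    (fun Q hQ => ⟨hsub Q hQ, by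
      rw [one_div, inv_mul_le_iff₀ (by positivity)]
      nlinarith [h𝓠 Q hQ]⟩) M
  choose! N hN0 hNcard hN using fun Q (hQ : Q ∈ 𝓠) =>
    exists_quarter_net hw (hs.trans_le (h𝓠 Q hQ)) hd
  have hmissle : ((missed w 𝓑 𝓠 f).card : ℝ) ≤ t * Real.exp (-d) := by
    have hMle : 16 * (t * (Real.log (D / t) + 5 * d)) ≤ M := Nat.le_ceil _
    have hexp : 4 * (d : ℝ) - M * (1 / (2 * t)) / 8 ≤ -Real.log (D / t) + -d := by
      have : Real.log (D / t) + 5 * d ≤ M * (1 / (2 * t)) / 8 := by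
        rw [mul_one_div, div_div, le_div_iff₀ (by positivity)]
        nlinarith
      linarith
    calc ((missed w 𝓑 𝓠 f).card : ℝ) ≤ 𝓠.card * Real.exp (4 * d - M * (1 / (2 * t)) / 8) := hmiss
      _ ≤ D * Real.exp (-Real.log (D / t) + -d) := by gcongr
      _ = t * Real.exp (-d) := by
          rw [Real.exp_add, Real.exp_neg, Real.exp_log (by positivity)]
          field_simp
  refine ⟨Finset.univ.image f ∪ (missed w 𝓑 𝓠 f).biUnion N, ?_, ?_, ?_⟩
  · intro a ha
    rcases Finset.mem_union.1 ha with ha | ha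
    · obtain ⟨j, -, rfl⟩ := Finset.mem_image.1 ha
      exact hf j
    · obtain ⟨Q, hQ, ha⟩ := Finset.mem_biUnion.1 ha
      exact hN0 Q (Finset.mem_filter.1 hQ).1 a ha
  · intro R hR
    obtain ⟨Q, hQ, hRQ⟩ := hcov R hR
    by_cases hm : Q ∈ missed w 𝓑 𝓠 f
    · refine (hN Q hQ R hR hRQ).mono (Finset.inter_subset_inter_left ?_)
      exact (Finset.subset_biUnion_of_mem N hm).trans Finset.subset_union_right
    · have : ∃ j, f j ∈ R ∩ Q := by
        by_contra! h
        exact hm (Finset.mem_filter.2 ⟨hQ, R, hR, hRQ, h⟩)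
      obtain ⟨j, hj⟩ := this
      exact ⟨f j, Finset.mem_inter.2 ⟨(Finset.mem_inter.1 hj).1,
        Finset.mem_union_left _ (Finset.mem_image_of_mem f (Finset.mem_univ j))⟩⟩
  · have h1 : (((missed w 𝓑 𝓠 f).biUnion N).card : ℝ) ≤
        (missed w 𝓑 𝓠 f).card * (32 * d + 1) := by
      have : ((missed w 𝓑 𝓠 f).biUnion N).card ≤ (missed w 𝓑 𝓠 f).card * (32 * d + 1) :=
        Finset.card_biUnion_le_card_mul _ _ _ fun Q hQ => hNcard Q (Finset.mem_filter.1 hQ).1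
      exact_mod_cast this
    have h2 : ((Finset.univ.image f).card : ℝ) ≤ M := by
      have := Finset.card_image_le (s := Finset.univ) (f := f)
      rw [Finset.card_univ, Fintype.card_fin] at this
      exact_mod_cast this
    -- The rounding term 1 is at most 2t because t ≥ 1/2.
    have h3 : (M : ℝ) ≤ 16 * (t * (Real.log (D / t) + 5 * d)) + 1 :=
      (Nat.ceil_lt_add_one (by positivity)).le
    have h4 : Real.exp (-d) * (32 * d + 1) ≤ 32 := by
      have := Real.add_one_le_exp (d : ℝ)
      rw [Real.exp_neg, inv_mul_le_iff₀ (Real.exp_pos _)]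
      nlinarith
    have h5 : ((missed w 𝓑 𝓠 f).card : ℝ) * (32 * d + 1) ≤ 32 * t :=
      calc _ ≤ t * Real.exp (-d) * (32 * d + 1) := by gcongr
        _ = t * (Real.exp (-d) * (32 * d + 1)) := by ring
        _ ≤ t * 32 := by gcongr
        _ = 32 * t := by ring
    have h6 : ((Finset.univ.image f ∪ (missed w 𝓑 𝓠 f).biUnion N).card : ℝ) ≤
        (Finset.univ.image f).card + ((missed w 𝓑 𝓠 f).biUnion N).card := by
      exact_mod_cast Finset.card_union_le _ _
    have h7 : 0 ≤ t * Real.log (D / t) := by positivity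
    nlinarith

end OneScale

/-! ### Packings, and the reduction to dyadic scales. -/

lemma mem_rangesLE {X : Type*} [MeasurableSpace X] {P : Measure X} {𝓡 : Finset (Finset X)} {t : ℝ}
    {R : Finset X} : R ∈ rangesLE P 𝓡 t ↔ R ∈ 𝓡 ∧ P.real (R : Set X) ≤ t := by
  classical exact Finset.mem_filter

section Packing

variable {X : Type*} [DecidableEq X] [MeasurableSpace X]

lemma card_le_packingNumber {P : Measure X} {𝓡 𝓠 : Finset (Finset X)} {t : ℝ} (h𝓠 : 𝓠 ⊆ 𝓡)
    (hpack : IsPacking P t 𝓠) : 𝓠.card ≤ packingNumber P 𝓡 t := by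
  classical
  exact Finset.le_sup (f := Finset.card)
    (Finset.mem_filter.2 ⟨Finset.mem_powerset.2 h𝓠, hpack⟩)

lemma packingNumber_le {P : Measure X} {𝓡 : Finset (Finset X)} {t : ℝ} {b : ℕ}
    (h : ∀ 𝓠 ⊆ 𝓡, IsPacking P t 𝓠 → 𝓠.card ≤ b) : packingNumber P 𝓡 t ≤ b := by
  classical
  refine Finset.sup_le fun 𝓠 h𝓠 => ?_
  obtain ⟨h1, h2⟩ := Finset.mem_filter.1 h𝓠
  exact h 𝓠 (Finset.mem_powerset.1 h1) h2

lemma packingNumber_le_doublingConstant (P : Measure X) (𝓡 : Finset (Finset X)) {ε s : ℝ}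
    (hs : ε ≤ s) : packingNumber P (rangesLE P 𝓡 (2 * s)) s ≤ doublingConstant P 𝓡 ε := by
  refine le_csSup ⟨𝓡.card, ?_⟩ ⟨s, hs, rfl⟩
  rintro _ ⟨r, -, rfl⟩
  exact packingNumber_le fun 𝓠 h𝓠 _ =>
    Finset.card_le_card (h𝓠.trans (Finset.filter_subset _ _))

lemma doublingConstant_le {P : Measure X} {𝓡 : Finset (Finset X)} {ε : ℝ} {b : ℕ}
    (h : ∀ s, ε ≤ s → ∀ 𝓠 ⊆ rangesLE P 𝓡 (2 * s), IsPacking P s 𝓠 → 𝓠.card ≤ b) :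
    doublingConstant P 𝓡 ε ≤ b := by
  refine csSup_le ⟨_, ε, Set.self_mem_Ici, rfl⟩ ?_
  rintro _ ⟨s, hs, rfl⟩
  exact packingNumber_le (h s hs)

lemma one_le_doublingConstant (P : Measure X) [IsProbabilityMeasure P] {𝓡 : Finset (Finset X)}
    (h : 𝓡.Nonempty) (ε : ℝ) : 1 ≤ doublingConstant P 𝓡 ε := by
  obtain ⟨R, hR⟩ := h
  -- At a scale of at least 1 no range is excluded by its measure.
  refine le_trans ?_ (packingNumber_le_doublingConstant P 𝓡 (le_max_left ε 1))
  refine le_trans (le_of_eq (Finset.card_singleton R).symm) (card_le_packingNumber ?_ ?_)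
  · rw [Finset.singleton_subset_iff, mem_rangesLE]
    have := measureReal_le_one (μ := P) (s := (R : Set X))
    exact ⟨hR, by linarith [le_max_right ε 1]⟩
  · intro A hA B hB hAB
    rw [Finset.mem_singleton] at hA hB
    exact absurd (hA.trans hB.symm) hAB

/-- A packing of maximal size is also a covering. -/
lemma exists_maximal_packing (P : Measure X) (𝓑 : Finset (Finset X)) (s : ℝ) :
    ∃ 𝓠 ⊆ 𝓑, IsPacking P s 𝓠 ∧
      ∀ R ∈ 𝓑, R ∉ 𝓠 → ∃ Q ∈ 𝓠, P.real (symmDiff R Q : Finset X) < s := by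
  classical
  obtain ⟨𝓠, h𝓠, hmax⟩ := Finset.exists_max_image (𝓑.powerset.filter fun 𝓠 => IsPacking P s 𝓠)
    Finset.card ⟨∅, by simp [IsPacking]⟩
  obtain ⟨hsub, hpack⟩ := Finset.mem_filter.1 h𝓠
  rw [Finset.mem_powerset] at hsub
  refine ⟨𝓠, hsub, hpack, fun R hR hRQ => ?_⟩
  by_contra! h
  have hins : IsPacking P s (insert R 𝓠) := by
    intro A hA B hB hAB
    rcases Finset.mem_insert.1 hA with rfl | hA' <;> rcases Finset.mem_insert.1 hB with rfl | hB'
    · exact absurd rfl hAB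
    · exact h B hB'
    · rw [symmDiff_comm]; exact h A hA'
    · exact hpack A hA' B hB' hAB
  have := hmax (insert R 𝓠) (Finset.mem_filter.2
    ⟨Finset.mem_powerset.2 (Finset.insert_subset hR hsub), hins⟩)
  rw [Finset.card_insert_of_notMem hRQ] at this
  omega

/-- Nets for the dyadic scales combine to an `ε`-net. -/
lemma exists_isEpsNet_of_scales (P : Measure X) [IsProbabilityMeasure P]
    {𝓡 : Finset (Finset X)} {ε : ℝ} (hε : 0 < ε) {T : ℕ → ℝ}
    (h : ∀ i ∈ Finset.Icc 1 (numScales ε), ∃ S : Finset X, (∀ a ∈ S, P {a} ≠ 0) ∧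
      (∀ R ∈ 𝓡, 2 ^ i * ε / 2 ≤ P.real (R : Set X) → P.real (R : Set X) ≤ 2 ^ i * ε →
        (R ∩ S).Nonempty) ∧ (S.card : ℝ) ≤ T i) :
    ∃ S : Finset X, IsEpsNet P 𝓡 ε S ∧
      (S.card : ℝ) ≤ ∑ i ∈ Finset.Icc 1 (numScales ε), T i := by
  choose! S hS0 hS hScard using h
  refine ⟨(Finset.Icc 1 (numScales ε)).biUnion S, ⟨fun a ha => ?_, fun R hR hRε => ?_⟩, ?_⟩
  · obtain ⟨i, hi, ha⟩ := Finset.mem_biUnion.1 ha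
    exact hS0 i hi a ha
  -- With 2^k ≤ P(R)/ε < 2^(k+1), the range is served by scale k + 1, since scale i covers measures
  -- from 2^i ε/2 to 2^i ε.
  · obtain ⟨k, hk1, hk2⟩ := exists_nat_pow_near ((one_le_div hε).2 hRε) one_lt_two
    rw [le_div_iff₀ hε] at hk1
    rw [div_lt_iff₀ hε] at hk2
    have hmem : k + 1 ∈ Finset.Icc 1 (numScales ε) := by
      refine Finset.mem_Icc.2 ⟨by omega, ?_⟩
      have h1 : (2 : ℝ) ^ k ≤ 1 / ε := by
        rw [le_div_iff₀ hε]; exact hk1.trans measureReal_le_one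
      have h2 : (k : ℝ) ≤ Real.logb 2 (1 / ε) := by
        rw [Real.le_logb_iff_rpow_le one_lt_two (by positivity), Real.rpow_natCast]
        exact h1
      have h3 : (k : ℤ) ≤ ⌈Real.logb 2 (1 / ε)⌉ := by
        exact_mod_cast h2.trans (Int.le_ceil _)
      unfold numScales
      omega
    refine (hS (k + 1) hmem R hR ?_ hk2.le).mono
      (Finset.inter_subset_inter_left (Finset.subset_biUnion_of_mem S hmem))
    rw [pow_succ]
    linarith
  · calc (((Finset.Icc 1 (numScales ε)).biUnion S).card : ℝ)
        ≤ ∑ i ∈ Finset.Icc 1 (numScales ε), ((S i).card : ℝ) := by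
          exact_mod_cast Finset.card_biUnion_le
      _ ≤ _ := Finset.sum_le_sum hScard

variable [MeasurableSingletonClass X]

lemma measureReal_symmDiff_add (P : Measure X) [IsProbabilityMeasure P] (A B : Finset X) :
    P.real (symmDiff A B : Finset X) + 2 * P.real (A ∩ B : Finset X) =
      P.real (A : Set X) + P.real (B : Set X) := by
  simp only [← sum_measureReal_singleton]
  have h1 := Finset.sum_inter_add_sum_sdiff A B fun a => P.real {a}
  have h2 := Finset.sum_inter_add_sum_sdiff B A fun a => P.real {a}
  have h3 : ∑ a ∈ symmDiff A B, P.real {a} =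
      ∑ a ∈ A \ B, P.real {a} + ∑ a ∈ B \ A, P.real {a} :=
    Finset.sum_union disjoint_sdiff_sdiff
  rw [Finset.inter_comm] at h2
  linarith

variable [Fintype X]

/-- A net for the ranges whose measure lies between `s` and `2 * s`. -/
lemma exists_net_of_scale (P : Measure X) [IsProbabilityMeasure P] {𝓡 : Finset (Finset X)}
    {d : ℕ} (hd : 𝓡.vcDim ≤ d) {s t D : ℝ} (hs : 0 < s) (ht : 1 / 2 ≤ t) (htD : t ≤ D)
    (hpack : (packingNumber P (rangesLE P 𝓡 (2 * s)) s : ℝ) ≤ D)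
    (hU : ∀ 𝓠 ⊆ rangesLE P 𝓡 (2 * s), (𝓠.card : ℝ) ≤ D →
      P.real (⋃ Q ∈ 𝓠, (Q : Set X)) ≤ 2 * s * t) :
    ∃ S : Finset X, (∀ a ∈ S, P {a} ≠ 0) ∧
      (∀ R ∈ 𝓡, s ≤ P.real (R : Set X) → P.real (R : Set X) ≤ 2 * s → (R ∩ S).Nonempty) ∧
      (S.card : ℝ) ≤ 80 * (t * (Real.log (D / t) + d + 1)) := by
  classical
  set 𝓑 := (rangesLE P 𝓡 (2 * s)).filter fun R : Finset X => s ≤ P.real (R : Set X) with h𝓑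
  have h𝓑sub : 𝓑 ⊆ rangesLE P 𝓡 (2 * s) := Finset.filter_subset _ _
  obtain ⟨𝓠, h𝓠, hpk, hcov⟩ := exists_maximal_packing P 𝓑 s
  have hcard : (𝓠.card : ℝ) ≤ D := le_trans
    (by exact_mod_cast card_le_packingNumber (h𝓠.trans h𝓑sub) hpk) hpack
  have hge : ∀ R ∈ 𝓑, s ≤ P.real (R : Set X) := fun R hR => (Finset.mem_filter.1 hR).2
  have hle : ∀ R ∈ 𝓑, P.real (R : Set X) ≤ 2 * s := fun R hR =>
    (mem_rangesLE.1 (h𝓑sub hR)).2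
  obtain ⟨S, hS0, hS, hScard⟩ := exists_transversal (w := fun a => P.real {a})
    (fun a => measureReal_nonneg) (𝓑 := 𝓑) (𝓠 := 𝓠)
    ((Finset.vcDim_mono (h𝓑sub.trans (Finset.filter_subset _ _))).trans hd) hs ht htD
    (fun Q hQ => by rw [sum_measureReal_singleton]; exact hge Q (h𝓠 hQ)) hcard
    (by
      rw [sum_measureReal_singleton, Finset.coe_biUnion]
      exact hU 𝓠 (h𝓠.trans h𝓑sub) hcard)
    (fun R hR => by
      simp only [sum_measureReal_singleton]
      by_cases hRQ : R ∈ 𝓠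
      · refine ⟨R, hRQ, ?_⟩
        rw [Finset.inter_self]
        linarith [hge R hR]
      -- 2P(R ∩ Q) = P(R) + P(Q) - P(R Δ Q) > P(Q), because P(R) ≥ s; so even half of `Q` is filled.
      · obtain ⟨Q, hQ, hlt⟩ := hcov R hR hRQ
        refine ⟨Q, hQ, ?_⟩
        linarith [measureReal_symmDiff_add P R Q, hge R hR, hge Q (h𝓠 hQ), hle Q (h𝓠 hQ)])
  refine ⟨S, fun a ha h0 => hS0 a ha ?_, fun R hR h1 h2 => ?_, hScard⟩
  · simp [measureReal_def, h0]
  · exact hS R (Finset.mem_filter.2 ⟨mem_rangesLE.2 ⟨hR, h2⟩, h1⟩)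

end Packing

/-! ### Basic properties of the capacity. -/

section Capacity

variable {X : Type*} [MeasurableSpace X]

lemma bddAbove_capacity (P : Measure X) [IsProbabilityMeasure P] (𝓡 : Finset (Finset X)) {ε : ℝ}
    (hε : 0 < ε) : BddAbove
      ((fun s : ℝ => P.real (⋃ R ∈ rangesLE P 𝓡 s, (R : Set X)) / s) '' Set.Ici ε) := by
  refine ⟨1 / ε, ?_⟩
  rintro _ ⟨s, hs, rfl⟩
  exact div_le_div₀ zero_le_one measureReal_le_one hε hs

lemma measureReal_biUnion_rangesLE_le (P : Measure X) [IsProbabilityMeasure P]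
    (𝓡 : Finset (Finset X)) {s : ℝ} (hs : 0 < s) :
    P.real (⋃ R ∈ rangesLE P 𝓡 s, (R : Set X)) ≤ s * capacity P 𝓡 s := by
  rw [← div_le_iff₀' hs]
  exact le_csSup (bddAbove_capacity P 𝓡 hs) ⟨s, Set.self_mem_Ici, rfl⟩

lemma capacity_nonneg (P : Measure X) [IsProbabilityMeasure P]
    (𝓡 : Finset (Finset X)) {s : ℝ} (hs : 0 < s) : 0 ≤ capacity P 𝓡 s :=
  nonneg_of_mul_nonneg_right
    (measureReal_nonneg.trans (measureReal_biUnion_rangesLE_le P 𝓡 hs)) hs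

lemma capacity_anti (P : Measure X) [IsProbabilityMeasure P]
    (𝓡 : Finset (Finset X)) {r s : ℝ} (hr : 0 < r) (hrs : r ≤ s) :
    capacity P 𝓡 s ≤ capacity P 𝓡 r :=
  csSup_le_csSup (bddAbove_capacity P 𝓡 hr) ⟨_, s, Set.self_mem_Ici, rfl⟩
    (Set.image_mono (Set.Ici_subset_Ici.2 hrs))

end Capacity

/-! ### Summation over the scales: the two upper bounds. -/

section UpperBounds

variable {X : Type*} [DecidableEq X] [MeasurableSpace X] [Fintype X] [MeasurableSingletonClass X]

/-- The bound of an `ε`-net by a decreasing majorant of the capacity. -/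
lemma exists_isEpsNet_of_capacity_le (P : Measure X) [IsProbabilityMeasure P]
    {𝓡 : Finset (Finset X)} {d : ℕ} (hd : 𝓡.vcDim ≤ d) {ε D : ℝ} (hε : 0 < ε)
    (hD : (doublingConstant P 𝓡 ε : ℝ) ≤ D) {τ : ℝ → ℝ}
    (hcap : ∀ s, 0 < s → capacity P 𝓡 s ≤ τ s) (hanti : ∀ r s, 0 < r → r ≤ s → τ s ≤ τ r)
    (hτD : 2 * τ (2 * ε) ≤ D) :
    ∃ S : Finset X, IsEpsNet P 𝓡 ε S ∧
      (S.card : ℝ) ≤ 240 * ∑ i ∈ Finset.Icc 1 (numScales ε),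
        (Real.log (D / τ (2 ^ i * ε)) + d) * τ (2 ^ i * ε) := by
  rw [Finset.mul_sum]
  refine exists_isEpsNet_of_scales P hε fun i hi => ?_
  have hi1 := (Finset.mem_Icc.1 hi).1
  have h2i : (2 : ℝ) ≤ 2 ^ i := by
    simpa using pow_le_pow_right₀ (one_le_two (α := ℝ)) hi1
  have hs : 0 < 2 ^ i * ε := by positivity
  set t := τ (2 ^ i * ε) with ht
  have ht0 : 0 ≤ t := (capacity_nonneg P 𝓡 hs).trans (hcap _ hs)
  have htD : 2 * t ≤ D := by
    have : t ≤ τ (2 * ε) := hanti _ _ (by positivity) (by gcongr)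
    linarith
  have hlog : 0 < t → Real.log 2 ≤ Real.log (D / t) := fun h =>
    Real.log_le_log two_pos ((le_div_iff₀ h).2 htD)
  have hunion : P.real (⋃ R ∈ rangesLE P 𝓡 (2 ^ i * ε), (R : Set X)) ≤ 2 ^ i * ε * t :=
    (measureReal_biUnion_rangesLE_le P 𝓡 hs).trans (by gcongr; exact hcap _ hs)
  by_cases hex : ∃ R ∈ 𝓡, 2 ^ i * ε / 2 ≤ P.real (R : Set X) ∧ P.real (R : Set X) ≤ 2 ^ i * ε
  · obtain ⟨R, hR, hR1, hR2⟩ := hex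
    -- One range at this scale already gives the union half of the mass 2^i ε.
    have hthalf : 1 / 2 ≤ t := by
      have h1 : P.real (R : Set X) ≤ P.real (⋃ R ∈ rangesLE P 𝓡 (2 ^ i * ε), (R : Set X)) :=
        measureReal_mono (Set.subset_biUnion_of_mem (u := fun R : Finset X => (R : Set X))
          (mem_rangesLE.2 ⟨hR, hR2⟩)) (measure_ne_top P _)
      by_contra! h
      nlinarith
    have htwo : 2 * (2 ^ i * ε / 2) = 2 ^ i * ε := by ring
    obtain ⟨S, hS0, hS, hScard⟩ := exists_net_of_scale P hd (s := 2 ^ i * ε / 2) (t := t) (D := D)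
      (by positivity) hthalf (by linarith)
      ((Nat.cast_le.2 (packingNumber_le_doublingConstant P 𝓡 (by nlinarith))).trans hD)
      (fun 𝓠 h𝓠 _ => by
        rw [htwo] at h𝓠 ⊢
        exact (measureReal_mono (Set.biUnion_mono h𝓠 fun _ _ => le_rfl)
          (measure_ne_top P _)).trans hunion)
    rw [htwo] at hS
    refine ⟨S, hS0, hS, hScard.trans ?_⟩
    have h2 := hlog (by linarith)
    have h3 := Real.log_two_gt_d9
    -- The 1 is absorbed because D ≥ 2t gives log(D/t) ≥ log 2 > 1/2.
    have : Real.log (D / t) + d + 1 ≤ 3 * (Real.log (D / t) + d) := by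
      have : (0 : ℝ) ≤ d := Nat.cast_nonneg d
      linarith
    nlinarith
  · refine ⟨∅, by simp, fun R hR h1 h2 => absurd ⟨R, hR, h1, h2⟩ hex, ?_⟩
    rw [Finset.card_empty, Nat.cast_zero]
    rcases ht0.eq_or_lt with h0 | h0
    · simp [← h0]
    · have : 0 ≤ Real.log (D / t) := (Real.log_nonneg one_le_two).trans (hlog h0)
      positivity

/-- Truncated subtraction makes the first k + 1 terms equal to 1; the others are a tail of ∑ (j +
1)/2^j = 4. The inductive bound uses the partial sums 4 - (j + 3)/2^j. -/
lemma sum_succ_div_two_pow_le (k z : ℕ) :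
    ∑ i ∈ Finset.Icc 1 z, (((i - (k + 1) : ℕ) : ℝ) + 1) / 2 ^ (i - (k + 1)) ≤ k + 5 := by
  have key : ∑ i ∈ Finset.Icc 1 z, (((i - (k + 1) : ℕ) : ℝ) + 1) / 2 ^ (i - (k + 1)) ≤
      (min z (k + 1) : ℕ) + 4 - (((z - (k + 1) : ℕ) : ℝ) + 3) / 2 ^ (z - (k + 1)) := by
    induction z with
    | zero => norm_num
    | succ z ih =>
      rw [Finset.sum_Icc_succ_top (by omega)]
      rcases Nat.lt_or_ge z (k + 1) with h | h
      · have h1 : z + 1 - (k + 1) = 0 := by omega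
        have h2 : z - (k + 1) = 0 := by omega
        have h3 : min (z + 1) (k + 1) = min z (k + 1) + 1 := by omega
        rw [h2] at ih
        rw [h1, h3, Nat.cast_add]
        norm_num at ih ⊢
        linarith
      · obtain ⟨j, rfl⟩ := Nat.exists_eq_add_of_le h
        have h1 : k + 1 + j + 1 - (k + 1) = j + 1 := by omega
        have h2 : k + 1 + j - (k + 1) = j := by omega
        have h3 : min (k + 1 + j + 1) (k + 1) = min (k + 1 + j) (k + 1) := by omega
        rw [h2] at ih
        rw [h1, h3]
        refine (add_le_add_left ih _).trans (le_of_eq ?_)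
        push_cast
        field_simp
        ring
  refine key.trans ?_
  have h1 : ((min z (k + 1) : ℕ) : ℝ) ≤ k + 1 := by exact_mod_cast min_le_right _ _
  have h2 : 0 ≤ (((z - (k + 1) : ℕ) : ℝ) + 3) / 2 ^ (z - (k + 1)) := by positivity
  linarith

/-- The bound of an `ε`-net by the doubling constant alone. -/
lemma exists_isEpsNet_of_doublingConstant_le (P : Measure X) [IsProbabilityMeasure P]
    {𝓡 : Finset (Finset X)} {d : ℕ} (hd : 𝓡.vcDim ≤ d) (hd1 : 1 ≤ d) {ε D : ℝ} (hε : 0 < ε)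
    (hD : (doublingConstant P 𝓡 ε : ℝ) ≤ D) (hDε : D ≤ 1 / (2 * ε)) :
    ∃ S : Finset X, IsEpsNet P 𝓡 ε S ∧
      (S.card : ℝ) ≤ 1440 * (d * D * Real.log (1 / (ε * D))) := by
  have hDnn : 0 ≤ D := (Nat.cast_nonneg _).trans hD
  rcases 𝓡.eq_empty_or_nonempty with rfl | hne
  · refine ⟨∅, ⟨by simp, by simp⟩, ?_⟩
    rw [Finset.card_empty, Nat.cast_zero]
    rcases hDnn.eq_or_lt with h0 | h0
    · simp [← h0]
    · have : 0 ≤ Real.log (1 / (ε * D)) := by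
        refine Real.log_nonneg ((one_le_div (by positivity)).2 ?_)
        rw [le_div_iff₀ (by positivity)] at hDε
        nlinarith
      positivity
  have hD1 : 1 ≤ D := le_trans (by exact_mod_cast one_le_doublingConstant P hne ε) hD
  have hd1' : (1 : ℝ) ≤ d := by exact_mod_cast hd1
  set y := 1 / (ε * D) with hy
  have hy2 : 2 ≤ y := by
    rw [hy, le_div_iff₀ (by positivity)]
    rw [le_div_iff₀ (by positivity)] at hDε
    linarith
  obtain ⟨k, hk1, hk2⟩ := exists_nat_pow_near (by linarith : 1 ≤ y) (one_lt_two (α := ℝ))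
  -- Scale i uses t = D/2^j, where j = i - (k + 1) truncated at 0. The threshold k + 1 is the first
  -- scale at which D ranges could exhaust the total mass.
  obtain ⟨S, hS, hScard⟩ := exists_isEpsNet_of_scales P (𝓡 := 𝓡) hε (T := fun i =>
      160 * (d * D) * ((((i - (k + 1) : ℕ) : ℝ) + 1) / 2 ^ (i - (k + 1)))) fun i hi => by
    have hi1 := (Finset.mem_Icc.1 hi).1
    have h2i : (2 : ℝ) ≤ 2 ^ i := by
      simpa using pow_le_pow_right₀ (one_le_two (α := ℝ)) hi1
    by_cases hex : ∃ R ∈ 𝓡, 2 ^ i * ε / 2 ≤ P.real (R : Set X)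
    swap
    · exact ⟨∅, by simp, fun R hR h1 _ => absurd ⟨R, hR, h1⟩ hex, by simp; positivity⟩
    obtain ⟨R, -, hR⟩ := hex
    have hsc : 2 ^ i * ε / 2 ≤ 1 := hR.trans measureReal_le_one
    set j := i - (k + 1) with hj
    have htwo : 2 * (2 ^ i * ε / 2) = 2 ^ i * ε := by ring
    -- Either the union bound over at most D ranges controls the mass of the union, or the required
    -- bound is at least 1 and holds trivially.
    have hcase : j = 0 ∨ 1 ≤ 2 ^ i * ε * (D / 2 ^ j) := by
      rcases Nat.lt_or_ge (k + 1) i with h | h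
      · right
        have hij : i = k + 1 + j := by omega
        have h1 : 1 ≤ 2 ^ (k + 1) * (ε * D) := by
          rw [hy, div_lt_iff₀ (by positivity)] at hk2
          exact hk2.le
        calc (1 : ℝ) ≤ 2 ^ (k + 1) * (ε * D) := h1
          _ = 2 ^ i * ε * (D / 2 ^ j) := by
              rw [hij, pow_add _ (k + 1) j]; field_simp
      · left; omega
    have htD : D / 2 ^ j ≤ D := div_le_self hDnn (one_le_pow₀ one_le_two)
    obtain ⟨S, hS0, hS, hScard⟩ := exists_net_of_scale P hd (s := 2 ^ i * ε / 2)
      (t := D / 2 ^ j) (D := D) (by positivity)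
      (by
        rcases hcase with h | h
        · rw [h]; norm_num; linarith
        · by_contra! hlt
          have : 0 < D / 2 ^ j := by positivity
          nlinarith)
      htD
      ((Nat.cast_le.2 (packingNumber_le_doublingConstant P 𝓡 (by nlinarith))).trans hD)
      (fun 𝓠 h𝓠 hcard => by
        rw [htwo] at h𝓠 ⊢
        rcases hcase with h | h
        · calc P.real (⋃ Q ∈ 𝓠, (Q : Set X)) ≤ ∑ Q ∈ 𝓠, P.real (Q : Set X) :=
                measureReal_biUnion_finset_le _ _
            _ ≤ ∑ _Q ∈ 𝓠, 2 ^ i * ε :=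
                Finset.sum_le_sum fun Q hQ => (mem_rangesLE.1 (h𝓠 hQ)).2
            _ = 𝓠.card * (2 ^ i * ε) := by rw [Finset.sum_const, nsmul_eq_mul]
            _ ≤ D * (2 ^ i * ε) := by gcongr
            _ = 2 ^ i * ε * (D / 2 ^ j) := by rw [h]; ring
        · exact measureReal_le_one.trans h)
    rw [htwo] at hS
    refine ⟨S, hS0, hS, hScard.trans ?_⟩
    have hlog : Real.log (D / (D / 2 ^ j)) ≤ j := by
      rw [div_div_cancel₀ (by positivity), Real.log_pow]
      have : Real.log 2 ≤ 1 := Real.log_two_lt_d9.le.trans (by norm_num)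
      have hj0 : (0 : ℝ) ≤ j := Nat.cast_nonneg j
      nlinarith
    calc 80 * (D / 2 ^ j * (Real.log (D / (D / 2 ^ j)) + d + 1))
        ≤ 80 * (D / 2 ^ j * (2 * d * (j + 1))) := by
          gcongr
          have hj0 : (0 : ℝ) ≤ j := Nat.cast_nonneg j
          nlinarith
      _ = 160 * (d * D) * (((j : ℝ) + 1) / 2 ^ j) := by ring
  refine ⟨S, hS, hScard.trans ?_⟩
  rw [← Finset.mul_sum]
  have hk : (k : ℝ) * Real.log 2 ≤ Real.log y := by
    rw [← Real.log_pow]; exact Real.log_le_log (by positivity) hk1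
  have h2y : Real.log 2 ≤ Real.log y := Real.log_le_log two_pos hy2
  have hl2 := Real.log_two_gt_d9
  -- As y ≥ 2, both k log 2 and log 2 are at most log y, and 6/log 2 < 9.
  have hk5 : (k : ℝ) + 5 ≤ 9 * Real.log y := by
    have hk0 : (0 : ℝ) ≤ k := Nat.cast_nonneg k
    nlinarith
  calc 160 * (d * D) * ∑ i ∈ Finset.Icc 1 (numScales ε),
        (((i - (k + 1) : ℕ) : ℝ) + 1) / 2 ^ (i - (k + 1))
      ≤ 160 * (d * D) * (9 * Real.log y) := by
        gcongr; exact (sum_succ_div_two_pow_le k _).trans hk5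
    _ = 1440 * (d * D * Real.log y) := by ring

end UpperBounds

/-! ### The block construction for the lower bound. -/

section LowerBound

variable {n : ℕ}

lemma measureReal_uniformOn_univ (A : Finset (Fin n)) :
    (ProbabilityTheory.uniformOn (Set.univ : Set (Fin n))).real (A : Set (Fin n)) =
      (A.card : ℝ) / n := by
  rw [measureReal_def, ProbabilityTheory.uniformOn_univ, Measure.count_apply_finset]
  simp

/-- There are disjoint sets of prescribed sizes with total size at most `n`. -/
lemma exists_pairwise_disjoint_card_eq {ι : Type*} [Fintype ι] (g : ι → ℕ)
    (hg : ∑ j, g j ≤ n) :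
    ∃ G : ι → Finset (Fin n), Pairwise (fun i j => Disjoint (G i) (G j)) ∧
      ∀ j, (G j).card = g j := by
  classical
  obtain ⟨φ⟩ := Function.Embedding.nonempty_of_card_le
    (α := Σ j, Fin (g j)) (β := Fin n) (by simpa using hg)
  refine ⟨fun j => Finset.univ.map ((Function.Embedding.sigmaMk j).trans φ), ?_, by simp⟩
  intro i j hij
  rw [Finset.disjoint_left]
  intro a hi hj
  obtain ⟨x, -, rfl⟩ := Finset.mem_map.1 hi
  obtain ⟨y, -, hy⟩ := Finset.mem_map.1 hj
  have := φ.injective hy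
  exact hij (congrArg Sigma.fst this).symm

variable {ι : Type*} [Fintype ι]

/-- All subsets of prescribed sizes of the blocks `G j`. -/
def blockRanges (G : ι → Finset (Fin n)) (s : ι → ℕ) : Finset (Finset (Fin n)) :=
  Finset.univ.biUnion fun j => (G j).powersetCard (s j)

lemma mem_blockRanges {G : ι → Finset (Fin n)} {s : ι → ℕ} {R : Finset (Fin n)} :
    R ∈ blockRanges G s ↔ ∃ j, R ⊆ G j ∧ R.card = s j := by
  simp [blockRanges]

variable {G : ι → Finset (Fin n)} {s : ι → ℕ} {e : ℕ}

/-- A shattered set lies in one block. The range cutting it in a single point a is in the same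
block, so the other points are among the e points that this range omits. The empty trace would not
do, as a range of another block may realize it; hence e + 1. -/
lemma vcDim_blockRanges_le (hG : Pairwise fun i j => Disjoint (G i) (G j))
    (hcard : ∀ j, (G j).card = s j + e) : (blockRanges G s).vcDim ≤ e + 1 := by
  refine Finset.sup_le fun Y hY => ?_
  rw [Finset.mem_shatterer] at hY
  rcases Y.eq_empty_or_nonempty with rfl | ⟨a, ha⟩
  · simp
  obtain ⟨R, hR, hYR⟩ := hY.exists_superset
  obtain ⟨j, hRj, -⟩ := mem_blockRanges.1 hR
  obtain ⟨R', hR', hYR'⟩ := hY.exists_inter_eq_singleton ha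
  obtain ⟨j', hRj', hRc'⟩ := mem_blockRanges.1 hR'
  have haR' : a ∈ R' := (Finset.mem_inter.1 (hYR' ▸ Finset.mem_singleton_self a)).2
  have hjj : j = j' := by
    by_contra hne
    exact Finset.disjoint_left.1 (hG hne) (hRj (hYR ha)) (hRj' haR')
  subst hjj
  have hsub : Y.erase a ⊆ G j \ R' := fun b hb => by
    obtain ⟨hba, hbY⟩ := Finset.mem_erase.1 hb
    refine Finset.mem_sdiff.2 ⟨hRj (hYR hbY), fun hbR => hba ?_⟩
    exact Finset.mem_singleton.1 (hYR' ▸ Finset.mem_inter.2 ⟨hbY, hbR⟩)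
  have h1 := Finset.card_le_card hsub
  rw [Finset.card_sdiff_of_subset hRj', hcard, hRc', Finset.card_erase_of_mem ha] at h1
  omega

lemma card_symmDiff_le_of_subset {Y : Type*} [DecidableEq Y] {A B g : Finset Y} {k : ℕ}
    (hg : g.card = k + e) (hA : A ⊆ g) (hAc : A.card = k) (hB : B ⊆ g) (hBc : B.card = k) :
    (symmDiff A B).card ≤ 2 * e := by
  have h1 := Finset.card_le_card (Finset.sdiff_subset_sdiff hA (le_refl B))
  have h2 := Finset.card_le_card (Finset.sdiff_subset_sdiff hB (le_refl A))
  rw [Finset.card_sdiff_of_subset hB, hg, hBc] at h1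
  rw [Finset.card_sdiff_of_subset hA, hg, hAc] at h2
  have h3 : (symmDiff A B).card ≤ (A \ B).card + (B \ A).card := Finset.card_union_le _ _
  omega

/-- An `ε`-net meets every block of large ranges in more than `e` points. -/
lemma card_mul_le_card_of_isEpsNet (hn : 0 < n) (hG : Pairwise fun i j => Disjoint (G i) (G j))
    (hcard : ∀ j, (G j).card = s j + e) {ε : ℝ} (hs : ∀ j, ε * n ≤ s j) {S : Finset (Fin n)}
    (hS : IsEpsNet (ProbabilityTheory.uniformOn (Set.univ : Set (Fin n))) (blockRanges G s) ε S) :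
    Fintype.card ι * (e + 1) ≤ S.card := by
  have hblock : ∀ j, e + 1 ≤ (G j ∩ S).card := by
    intro j
    by_contra! h
    have h1 : s j ≤ (G j \ S).card := by
      have := Finset.card_inter_add_card_sdiff (G j) S
      rw [hcard] at this
      omega
    obtain ⟨R, hR, hRc⟩ := Finset.exists_subset_card_eq h1
    have h2 := hS.2 R (mem_blockRanges.2 ⟨j, hR.trans Finset.sdiff_subset, hRc⟩) (by
      rw [measureReal_uniformOn_univ, hRc, le_div_iff₀ (by exact_mod_cast hn)]
      exact hs j)
    obtain ⟨a, ha⟩ := h2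
    exact (Finset.mem_sdiff.1 (hR (Finset.mem_inter.1 ha).1)).2 (Finset.mem_inter.1 ha).2
  calc Fintype.card ι * (e + 1) = ∑ _j : ι, (e + 1) := by simp
    _ ≤ ∑ j, (G j ∩ S).card := Finset.sum_le_sum fun j _ => hblock j
    _ = (Finset.univ.biUnion fun j => G j ∩ S).card :=
        (Finset.card_biUnion fun i _ j _ hij =>
          (hG hij).mono Finset.inter_subset_left Finset.inter_subset_left).symm
    _ ≤ S.card := Finset.card_le_card
        (Finset.biUnion_subset.2 fun j _ => Finset.inter_subset_right)

/-- Blocks of geometrically growing sizes, `b` of each size, have doubling constant at most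
`b + 1`. -/
lemma doublingConstant_blockRanges_le (hn : 0 < n) {m b a : ℕ} (ha : 0 < a)
    {G : Fin m × Fin b → Finset (Fin n)} (hcard : ∀ j, (G j).card = 5 ^ (j.1 : ℕ) * a + e)
    {ε : ℝ} (hε : (2 * e : ℕ) < ε * n) :
    doublingConstant (ProbabilityTheory.uniformOn (Set.univ : Set (Fin n)))
      (blockRanges G fun j => 5 ^ (j.1 : ℕ) * a) ε ≤ b + 1 := by
  classical
  have hn' : (0 : ℝ) < n := by exact_mod_cast hn
  refine doublingConstant_le fun r hr 𝓠 h𝓠 hpack => ?_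
  have hdist : ∀ A ∈ 𝓠, ∀ B ∈ 𝓠, A ≠ B → r * n ≤ ((symmDiff A B).card : ℝ) := by
    intro A hA B hB hAB
    have := hpack A hA B hB hAB
    rwa [measureReal_uniformOn_univ, le_div_iff₀ hn'] at this
  have hle : ∀ A ∈ 𝓠, (A.card : ℝ) ≤ 2 * (r * n) := by
    intro A hA
    have := (mem_rangesLE.1 (h𝓠 hA)).2
    rw [measureReal_uniformOn_univ, div_le_iff₀ hn'] at this
    linarith
  have hblk : ∀ A ∈ 𝓠, ∃ j : Fin m × Fin b, A ⊆ G j ∧ A.card = 5 ^ (j.1 : ℕ) * a :=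
    fun A hA => mem_blockRanges.1 (mem_rangesLE.1 (h𝓠 hA)).1
  -- Two ranges this small are closer than r; this accounts for the extra 1 in b + 1.
  have hsmall : (𝓠.filter fun A => (A.card : ℝ) < r * n / 2).card ≤ 1 := by
    refine Finset.card_le_one.2 fun A hA B hB => ?_
    obtain ⟨hA, hA2⟩ := Finset.mem_filter.1 hA
    obtain ⟨hB, hB2⟩ := Finset.mem_filter.1 hB
    by_contra hne
    have h1 := hdist A hA B hB hne
    have h2 : ((symmDiff A B).card : ℝ) ≤ A.card + B.card := by
      have : (symmDiff A B).card ≤ A.card + B.card :=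
        (Finset.card_union_le _ _).trans (add_le_add (Finset.card_le_card Finset.sdiff_subset)
          (Finset.card_le_card Finset.sdiff_subset))
      exact_mod_cast this
    linarith
  -- The remaining sizes lie within a factor 4, less than the ratio 5 of consecutive sizes, so only
  -- one size occurs. Each of its b blocks contributes at most one range, since ranges of a block
  -- are at distance at most 2e < εn.
  have hlarge : (𝓠.filter fun A => ¬ (A.card : ℝ) < r * n / 2).card ≤ b := by
    rcases 𝓠.eq_empty_or_nonempty with rfl | ⟨A₀, hA₀⟩
    · simp
    obtain ⟨j₀, -, -⟩ := hblk A₀ hA₀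
    have : Nonempty (Fin m × Fin b) := ⟨j₀⟩
    choose! J hJ1 hJ2 using hblk
    have hnlt : ∀ A ∈ 𝓠, ∀ B ∈ 𝓠, r * n / 2 ≤ (A.card : ℝ) → ¬ (J A).1 < (J B).1 := by
      intro A hA B hB hAr hlt
      have h1 : 5 * A.card ≤ B.card := by
        rw [hJ2 A hA, hJ2 B hB, ← mul_assoc, ← pow_succ']
        exact Nat.mul_le_mul_right a (Nat.pow_le_pow_right (by norm_num) hlt)
      have h2 : 5 * (A.card : ℝ) ≤ B.card := by exact_mod_cast h1
      have h3 : (0 : ℝ) < A.card := by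
        rw [hJ2 A hA]; positivity
      linarith [hle B hB]
    have := Finset.card_le_card_of_injOn (s := 𝓠.filter fun A => ¬ (A.card : ℝ) < r * n / 2)
      (t := (Finset.univ : Finset (Fin b))) (fun A => (J A).2) (fun _ _ => Finset.mem_univ _)
      (by
        intro A hA B hB hAB
        obtain ⟨hA, hA2⟩ := Finset.mem_filter.1 hA
        obtain ⟨hB, hB2⟩ := Finset.mem_filter.1 hB
        have hJ : J A = J B := Prod.ext (le_antisymm
          (not_lt.1 (hnlt B hB A hA (not_lt.1 hB2))) (not_lt.1 (hnlt A hA B hB (not_lt.1 hA2))))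
          hAB
        by_contra hne
        have h1 := hdist A hA B hB hne
        have h2 := card_symmDiff_le_of_subset (hcard (J A))
          (hJ1 A hA) (hJ2 A hA) (hJ ▸ hJ1 B hB) (hJ ▸ hJ2 B hB)
        have h3 : ((symmDiff A B).card : ℝ) ≤ (2 * e : ℕ) := by exact_mod_cast h2
        have h4 : ε * n ≤ r * n := by gcongr
        linarith)
    simpa using this
  have := Finset.card_filter_add_card_filter_not (s := 𝓠) fun A => (A.card : ℝ) < r * n / 2
  omega

/-- Blocks of subsets of all the sizes `5 ^ i * ⌈ε * n⌉` show that the bound of an `ε`-net by the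
doubling constant is sharp. -/
lemma exists_ranges_forall_isEpsNet_card_ge {d : ℕ} {ε D : ℝ} (hn : 0 < n)
    (hε : (d : ℝ) / n < ε) (hD : 2 ≤ D) (hDε : D < 1 / (2 * ε)) :
    ∃ 𝓡 : Finset (Finset (Fin n)), 𝓡.vcDim ≤ d ∧
      (doublingConstant (ProbabilityTheory.uniformOn (Set.univ : Set (Fin n))) 𝓡 ε : ℝ) ≤ D ∧
      ∀ S : Finset (Fin n),
        IsEpsNet (ProbabilityTheory.uniformOn (Set.univ : Set (Fin n))) 𝓡 ε S →
        1 / 32 * (d * D * Real.log (1 / (ε * D))) ≤ S.card := by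
  have hn' : (0 : ℝ) < n := by exact_mod_cast hn
  have hε0 : 0 < ε := lt_of_le_of_lt (by positivity) hε
  rcases Nat.eq_zero_or_pos d with rfl | hd
  · refine ⟨∅, by simp [Finset.vcDim, Finset.shatterer], ?_, by simp⟩
    have h0 : doublingConstant (ProbabilityTheory.uniformOn (Set.univ : Set (Fin n)))
        (∅ : Finset (Finset (Fin n))) ε ≤ 0 :=
      doublingConstant_le fun r _ 𝓠 h𝓠 _ => by
        rw [Nat.le_zero, Finset.card_eq_zero, ← Finset.subset_empty]
        exact h𝓠.trans (Finset.filter_subset _ _)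
    rw [Nat.le_zero.1 h0]
    push_cast
    linarith
  have hd1 : (1 : ℝ) ≤ d := by exact_mod_cast hd
  have hεn : (d : ℝ) < ε * n := by rwa [div_lt_iff₀ hn'] at hε
  have hεD : ε * D < 1 / 2 := by
    rw [lt_div_iff₀ (by positivity)] at hDε; linarith
  have hεD0 : 0 < ε * D := by positivity
  set y := 1 / (ε * D) with hy
  have hy2 : 2 < y := by rw [hy, lt_div_iff₀ hεD0]; linarith
  -- The constant 16/5 makes the blocks fit: b ≤ D/2, the geometric sum is at most 5^m/4, and a + e
  -- ≤ (5/2)εn, so the total is at most n·y·εD = n.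
  obtain ⟨m, hm1, hm2⟩ := exists_nat_pow_near (x := 16 / 5 * y) (y := 5) (by linarith) (by norm_num)
  have hm0 : 1 ≤ m := by
    by_contra! h
    have : m = 0 := by omega
    rw [this] at hm2
    norm_num at hm2
    linarith
  have hyεD : y * (ε * D) = 1 := by rw [hy]; field_simp
  set b := ⌊D / 2⌋₊ with hb
  have hb1 : 1 ≤ b := Nat.le_floor (by push_cast; linarith)
  have hbD : (b : ℝ) ≤ D / 2 := Nat.floor_le (by linarith)
  have hbD' : D / 4 ≤ b := by
    have h1 : D / 2 < b + 1 := Nat.lt_floor_add_one _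
    have h2 : (1 : ℝ) ≤ b := by exact_mod_cast hb1
    linarith
  set a := ⌈ε * n⌉₊ with ha
  have ha0 : 0 < a := Nat.ceil_pos.2 (by positivity)
  have ha1 : ε * n ≤ a := Nat.le_ceil _
  have ha2 : (a : ℝ) < ε * n + 1 := Nat.ceil_lt_add_one (by positivity)
  set e := d / 2 with he
  have he2 : ((2 * e : ℕ) : ℝ) ≤ d := by exact_mod_cast (by omega : 2 * e ≤ d)
  have hed : (d : ℝ) ≤ 2 * (e + 1) := by exact_mod_cast (by omega : d ≤ 2 * (e + 1))
  have hae : (a : ℝ) + e ≤ 5 / 2 * (ε * n) := by push_cast at he2; linarith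
  have hgeom : (∑ i ∈ Finset.range m, (5 : ℝ) ^ i) ≤ 5 ^ m / 4 := by
    rw [geom_sum_eq (by norm_num)]
    have : (0 : ℝ) < 5 ^ m := by positivity
    linarith
  have hsum : ∑ j : Fin m × Fin b, (5 ^ (j.1 : ℕ) * a + e) ≤ n := by
    have hreal : ((∑ j : Fin m × Fin b, (5 ^ (j.1 : ℕ) * a + e) : ℕ) : ℝ) ≤ n := by
      push_cast
      calc ∑ j : Fin m × Fin b, ((5 : ℝ) ^ (j.1 : ℕ) * a + e)
          ≤ ∑ j : Fin m × Fin b, (5 : ℝ) ^ (j.1 : ℕ) * (a + e) := by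
            refine Finset.sum_le_sum fun j _ => ?_
            have h1 : (1 : ℝ) ≤ 5 ^ (j.1 : ℕ) := one_le_pow₀ (by norm_num)
            have h2 : (0 : ℝ) ≤ e := Nat.cast_nonneg e
            nlinarith
        _ = b * ((∑ i ∈ Finset.range m, (5 : ℝ) ^ i) * (a + e)) := by
            rw [Fintype.sum_prod_type, Finset.sum_range, Finset.sum_mul, Finset.mul_sum]
            simp
        _ ≤ D / 2 * (5 ^ m / 4 * (5 / 2 * (ε * n))) := by gcongr
        _ ≤ D / 2 * (16 / 5 * y / 4 * (5 / 2 * (ε * n))) := by gcongr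
        _ = n * (y * (ε * D)) := by ring
        _ = n := by rw [hyεD, mul_one]
    exact_mod_cast hreal
  obtain ⟨G, hG, hcard⟩ := exists_pairwise_disjoint_card_eq _ hsum
  refine ⟨blockRanges G fun j => 5 ^ (j.1 : ℕ) * a, ?_, ?_, fun S hS => ?_⟩
  · have h1 := vcDim_blockRanges_le hG hcard
    omega
  · have h1 := doublingConstant_blockRanges_le hn ha0 hcard (he2.trans_lt hεn)
    calc _ ≤ ((b + 1 : ℕ) : ℝ) := Nat.cast_le.2 h1
      _ ≤ D := by push_cast; linarith
  · have h1 := card_mul_le_card_of_isEpsNet hn hG hcard (fun j => by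
      push_cast
      have h1 : (1 : ℝ) ≤ 5 ^ (j.1 : ℕ) := one_le_pow₀ (by norm_num)
      nlinarith) hS
    rw [Fintype.card_prod, Fintype.card_fin, Fintype.card_fin] at h1
    have h2 : (m : ℝ) * b * (e + 1) ≤ S.card := by exact_mod_cast h1
    refine le_trans ?_ h2
    have hlog0 : 0 ≤ Real.log y := Real.log_nonneg (by linarith)
    have hlog : Real.log y ≤ 4 * m := by
      have h5 : Real.log 5 ≤ 2 := by
        rw [Real.log_le_iff_le_exp (by norm_num)]
        have h3 := Real.exp_one_gt_d9
        have h4 : Real.exp 2 = Real.exp 1 ^ 2 := by rw [← Real.exp_nat_mul]; norm_num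
        rw [h4]
        nlinarith
      have h6 : Real.log y ≤ (m + 1 : ℕ) * Real.log 5 := by
        rw [← Real.log_pow]
        exact Real.log_le_log (by linarith) (by linarith)
      have h7 : (1 : ℝ) ≤ m := by exact_mod_cast hm0
      push_cast at h6
      nlinarith
    -- The constant 32 = 2·4·4 collects the losses d ≤ 2(e + 1), D ≤ 4b and log y ≤ 4m.
    calc 1 / 32 * (d * D * Real.log y) ≤ 1 / 32 * ((2 * (e + 1)) * (4 * b) * (4 * m)) := by
          gcongr; linarith
      _ = m * b * (e + 1) := by ring

end LowerBound

end RangeSpace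

/-- The degenerate readings are automatic: a summand with τ = 0 carries the factor 0, and so does
the bound in (ii) when D = 0. -/
theorem theorem4 :
    -- (i), for the capacity itself as well as for the capacity cut off at `1`
    (∃ C : ℝ, 0 < C ∧
      ∀ (X : Type*) [Fintype X] [DecidableEq X] [MeasurableSpace X] [MeasurableSingletonClass X]
        (P : Measure X) [IsProbabilityMeasure P] (𝓡 : Finset (Finset X)) (d : ℕ) (ε D : ℝ)
        (τ : ℝ → ℝ),
        𝓡.vcDim ≤ d → 0 < ε → (RangeSpace.doublingConstant P 𝓡 ε : ℝ) ≤ D →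
        (τ = RangeSpace.capacity P 𝓡 ∨ τ = RangeSpace.truncCapacity P 𝓡) →
        2 * τ (2 * ε) ≤ D →
        ∃ S : Finset X, RangeSpace.IsEpsNet P 𝓡 ε S ∧
          (S.card : ℝ) ≤ C * ∑ i ∈ Finset.Icc 1 (RangeSpace.numScales ε),
            (Real.log (D / τ (2 ^ i * ε)) + d) * τ (2 ^ i * ε)) ∧
    -- (ii), upper bound
    (∃ C : ℝ, 0 < C ∧
      ∀ (X : Type*) [Fintype X] [DecidableEq X] [MeasurableSpace X] [MeasurableSingletonClass X]
        (P : Measure X) [IsProbabilityMeasure P] (𝓡 : Finset (Finset X)) (d : ℕ) (ε D : ℝ),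
        𝓡.vcDim ≤ d → 1 ≤ d → 0 < ε → (RangeSpace.doublingConstant P 𝓡 ε : ℝ) ≤ D →
        D ≤ 1 / (2 * ε) →
        ∃ S : Finset X, RangeSpace.IsEpsNet P 𝓡 ε S ∧
          (S.card : ℝ) ≤ C * (d * D * Real.log (1 / (ε * D)))) ∧
    -- (ii), lower bound
    (∃ c : ℝ, 0 < c ∧
      ∀ (n d : ℕ) (ε D : ℝ), 0 < n → (d : ℝ) / n < ε → 2 ≤ D → D < 1 / (2 * ε) →
        ∃ 𝓡 : Finset (Finset (Fin n)),
          𝓡.vcDim ≤ d ∧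
          (RangeSpace.doublingConstant
            (ProbabilityTheory.uniformOn (Set.univ : Set (Fin n))) 𝓡 ε : ℝ) ≤ D ∧
          ∀ S : Finset (Fin n),
            RangeSpace.IsEpsNet (ProbabilityTheory.uniformOn (Set.univ : Set (Fin n))) 𝓡 ε S →
            c * (d * D * Real.log (1 / (ε * D))) ≤ S.card) := by
  refine ⟨⟨240, by norm_num, ?_⟩, ⟨1440, by norm_num, ?_⟩, ⟨1 / 32, by norm_num, ?_⟩⟩
  · intro X _ _ _ _ P _ 𝓡 d ε D τ hd hε hD hτ hτD
    refine RangeSpace.exists_isEpsNet_of_capacity_le P hd hε hD ?_ ?_ hτD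
    · rcases hτ with rfl | rfl
      · exact fun s _ => le_rfl
      · exact fun s _ => le_max_left _ _
    · rcases hτ with rfl | rfl
      · exact fun r s hr hrs => RangeSpace.capacity_anti P 𝓡 hr hrs
      · exact fun r s hr hrs => max_le_max_right 1 (RangeSpace.capacity_anti P 𝓡 hr hrs)
  · intro X _ _ _ _ P _ 𝓡 d ε D hd hd1 hε hD hDε
    exact RangeSpace.exists_isEpsNet_of_doublingConstant_le P hd hd1 hε hD hDε
  · intro n d ε D hn hε hD hDε
    exact RangeSpace.exists_ranges_forall_isEpsNet_card_ge hn hε hD hDε
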